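/- Let $n\ge 1$ be an integer and $1<p<\infty$. For a locally integrable function $f$ on $\mathbb R^n$ define the strong maximal function $$(\mathcal N_n f)(x)=\sup_{a_i<x_i<b_i,\ i=1,\dots,n}\ \frac{1}{(b_1-a_1)\cdots(b_n-a_n)}\int_{a_1}^{b_1}\!\!\cdots\int_{a_n}^{b_n}|f(y_1,\dots,y_n)|\,dy_n\cdots dy_1 .$$ Then the equation $$(p-1)\,x^{p}-p\,x^{p-1}-1=0$$ has a unique positive solution $c_p$, the operator $\mathcal N_n$ maps $L^p(\mathbb R^n)$ into $L^p(\mathbb R^n)$, and its operator norm, that is, the least $C\ge 0$ such that $\|\mathcal N_n f\|_{L^p(\mathbb R^n)}\le C\,\|f\|_{L^p(\mathbb R^n)}$ for all $f\in L^p(\mathbb R^n)$, is equal to $c_p^{\,n}$. -/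

import Mathlib

open MeasureTheory
open scoped ENNReal

noncomputable section

/-- The strong maximal function `𝒩ₙ f` on `ℝⁿ`: the supremum of the averages of `|f|` over all
boxes `[a₁, b₁] × ⋯ × [aₙ, bₙ]` with `aᵢ < xᵢ < bᵢ` for every `i`. It takes values in `[0, ∞]`. -/
def strongMaximal {n : ℕ} {𝕜 : Type*} [RCLike 𝕜] (f : (Fin n → ℝ) → 𝕜) (x : Fin n → ℝ) : ℝ≥0∞ :=
  ⨆ (a : Fin n → ℝ) (b : Fin n → ℝ) (_ : ∀ i, a i < x i ∧ x i < b i),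
    (∏ i, ENNReal.ofReal (b i - a i))⁻¹ * ∫⁻ y in Set.Icc a b, ‖f y‖ₑ

/-- The operator norm on `L^p(μ)` of a (not necessarily linear) operator `T` whose values are
`[0, ∞]`-valued functions: the infimum of all `C ∈ [0, ∞]` with `‖T f‖_p ≤ C ‖f‖_p` for every
`f ∈ L^p(μ)`. -/
def lpOperatorNorm {α 𝕜 : Type*} [MeasurableSpace α] [RCLike 𝕜]
    (T : (α → 𝕜) → α → ℝ≥0∞) (p : ℝ≥0∞) (μ : Measure α) : ℝ≥0∞ :=
  sInf {C : ℝ≥0∞ | ∀ f : α → 𝕜, MemLp f p μ → eLpNorm (T f) p μ ≤ C * eLpNorm f p μ}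

end

/-! On the line, write `M g` for the uncentred maximal function. Everything rests on a weak type
inequality with an extra term: t|{M g > t}| + t|{g > t}| ≤ ∫_{M g > t} g + ∫_{g > t} g
(`mul_measure_lt_intervalMaximal_add_le`). It holds because intervals on the line can be thinned to
overlap at most twice without changing their union, and the part counted twice costs at most ∫ (g -
t)⁺.

Integrating over t with weight p(p - 1)t^(p-2) gives (p - 1)(∫ (M g)^p + ∫ g^p) ≤ p(∫ g (M g)^(p-1)
+ ∫ g^p). Young's inequality, balanced at `M g = c * g`, bounds the mixed integral, and the equation
for c is exactly what makes the resulting constant c^p (`lintegral_intervalMaximal_rpow_le`). In n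
variables the box maximal function is dominated by iterated one-variable ones
(`boxMaximal_cons_le`), so Tonelli gives c^n.

For sharpness, |x|^(-α) is homogeneous, so averaging over an interval proportional to x multiplies
it by a constant; as α → 1/p the best constant tends to c. Products of truncated powers give c^n
(`truncPowFactor_pow_le_lpOperatorNorm`, `tendsto_truncPowFactor`). -/

/-! ### The equation for c. -/

/-- For `x > p / (p - 1)` the left-hand side of the equation defining `c_p` is strictly monotone. -/
theorem rpow_mul_sub_lt_of_lt {p x y : ℝ} (hp : 1 < p) (hx : 0 < x) (hxp : 0 < (p - 1) * x - p)
    (hxy : x < y) :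
    (p - 1) * x ^ p - p * x ^ (p - 1) < (p - 1) * y ^ p - p * y ^ (p - 1) := by
  have key : ∀ z : ℝ, 0 < z →
      (p - 1) * z ^ p - p * z ^ (p - 1) = z ^ (p - 1) * ((p - 1) * z - p) := by
    intro z hz
    have : z ^ p = z ^ (p - 1) * z := by
      rw [← Real.rpow_add_one hz.ne']; congr 1; ring
    rw [this]; ring
  rw [key x hx, key y (hx.trans hxy)]
  have h1 : x ^ (p - 1) < y ^ (p - 1) := Real.rpow_lt_rpow hx.le hxy (by linarith)
  have h2 : (p - 1) * x - p < (p - 1) * y - p := by nlinarith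
  exact mul_lt_mul'' h1 h2 (by positivity) hxp.le

/-- The equation factors as c^(p-1) ((p - 1)c - p) = 1, so positive roots lie only where the
left-hand side is strictly monotone. -/
theorem pos_of_root {p c : ℝ} (hc : 0 < c)
    (h : (p - 1) * c ^ p - p * c ^ (p - 1) - 1 = 0) : 0 < (p - 1) * c - p := by
  have : c ^ p = c ^ (p - 1) * c := by
    rw [← Real.rpow_add_one hc.ne']; congr 1; ring
  rw [this] at h
  have h3 : c ^ (p - 1) * ((p - 1) * c - p) = 1 := by linarith
  by_contra hcon
  have := mul_nonneg (Real.rpow_nonneg hc.le (p - 1)) (by linarith : 0 ≤ -((p - 1) * c - p))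
  linarith

theorem one_lt_of_root {p c : ℝ} (hp : 1 < p) (hc : 0 < c)
    (h : (p - 1) * c ^ p - p * c ^ (p - 1) - 1 = 0) : 1 < c := by
  have := pos_of_root hc h
  nlinarith

theorem existsUnique_root {p : ℝ} (hp : 1 < p) :
    ∃! c : ℝ, 0 < c ∧ (p - 1) * c ^ p - p * c ^ (p - 1) - 1 = 0 := by
  obtain ⟨c, hc, hroot⟩ : ∃ c : ℝ, 0 < c ∧ (p - 1) * c ^ p - p * c ^ (p - 1) - 1 = 0 := by
    have hcont : ContinuousOn (fun c : ℝ => (p - 1) * c ^ p - p * c ^ (p - 1) - 1)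
        (Set.Icc 1 ((p + 1) / (p - 1))) := by
      have h0 : 0 ≤ p := by linarith
      have h1 : 0 ≤ p - 1 := by linarith
      exact (((Real.continuous_rpow_const h0).const_mul _).sub
        ((Real.continuous_rpow_const h1).const_mul _)).sub continuous_const |>.continuousOn
    have hle : (1 : ℝ) ≤ (p + 1) / (p - 1) := by
      rw [le_div_iff₀ (by linarith)]; linarith
    -- The value at 1 is -2; at z = (p + 1)/(p - 1) the factor (p - 1)z - p is 1, leaving z^(p-1) -
    -- 1 ≥ 0.
    have hmem : (0 : ℝ) ∈ Set.Icc ((p - 1) * (1 : ℝ) ^ p - p * (1 : ℝ) ^ (p - 1) - 1)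
        ((p - 1) * ((p + 1) / (p - 1)) ^ p - p * ((p + 1) / (p - 1)) ^ (p - 1) - 1) := by
      constructor
      · simp
      · set z := (p + 1) / (p - 1) with hz
        have hz0 : 0 < z := by linarith
        have : z ^ p = z ^ (p - 1) * z := by
          rw [← Real.rpow_add_one hz0.ne']; congr 1; ring
        have h1 : 1 ≤ z ^ (p - 1) := Real.one_le_rpow hle (by linarith)
        have h2 : (p - 1) * z = p + 1 := by
          rw [hz]; field_simp [show p - 1 ≠ 0 by linarith]
        rw [this]
        have : (p - 1) * (z ^ (p - 1) * z) = z ^ (p - 1) * (p + 1) := by rw [← h2]; ring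
        rw [this]; linarith
    obtain ⟨c, hc, hc'⟩ := intermediate_value_Icc hle hcont hmem
    exact ⟨c, by linarith [hc.1], hc'⟩
  refine ⟨c, ⟨hc, hroot⟩, ?_⟩
  rintro d ⟨hd, hdroot⟩
  rcases lt_trichotomy d c with hlt | heq | hlt
  · have := rpow_mul_sub_lt_of_lt hp hd (pos_of_root hd hdroot) hlt
    linarith
  · exact heq
  · have := rpow_mul_sub_lt_of_lt hp hc (pos_of_root hc hroot) hlt
    linarith

/-! ### The sharp weak type inequality on the line. -/

/-- Every finite family of intervals has a subfamily with the same union in which no point lies in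
more than two intervals. -/
theorem exists_subfamily_overlap_le_two {ι : Type*} (s : Finset ι) (a b : ι → ℝ) :
    ∃ t ⊆ s, (⋃ i ∈ t, Set.Ioo (a i) (b i)) = (⋃ i ∈ s, Set.Ioo (a i) (b i)) ∧
      ∀ x, (t.filter fun i => x ∈ Set.Ioo (a i) (b i)).card ≤ 2 := by
  classical
  -- Take a subfamily of least cardinality with the same union: none of its members is redundant.
  obtain ⟨t, ht, hmin⟩ := (s.powerset.filter fun t =>
      (⋃ i ∈ t, Set.Ioo (a i) (b i)) = (⋃ i ∈ s, Set.Ioo (a i) (b i))).exists_min_image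
    Finset.card ⟨s, by simp⟩
  simp only [Finset.mem_filter, Finset.mem_powerset] at ht hmin
  refine ⟨t, ht.1, ht.2, fun x => ?_⟩
  by_contra! hcard
  set u := t.filter fun i => x ∈ Set.Ioo (a i) (b i) with hu
  have hne : u.Nonempty := Finset.card_pos.mp (by omega)
  -- Among the intervals through x, the one reaching furthest left and the one reaching furthest
  -- right cover all the others, so a third one could be dropped.
  obtain ⟨l, hl, hl'⟩ := u.exists_min_image a hne
  obtain ⟨r, hr, hr'⟩ := u.exists_max_image b hne
  obtain ⟨k, hk, hkl⟩ : ∃ k ∈ u, k ∉ ({l, r} : Finset ι) := by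
    by_contra! hcon
    have := (Finset.card_le_card (show u ⊆ {l, r} from hcon)).trans Finset.card_le_two
    omega
  simp only [Finset.mem_insert, Finset.mem_singleton, not_or] at hkl
  have hmem : ∀ {i}, i ∈ u → i ∈ t ∧ a i < x ∧ x < b i := by
    intro i hi; simpa [hu] using hi
  have hlt : (t.erase k).card < t.card := Finset.card_erase_lt_of_mem (hmem hk).1
  refine absurd (hmin (t.erase k) ⟨(Finset.erase_subset _ _).trans ht.1, ?_⟩) (by omega)
  rw [← ht.2]
  refine subset_antisymm (Set.biUnion_mono (by simp) fun _ _ => subset_rfl) ?_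
  intro y hy
  simp only [Set.mem_iUnion, exists_prop] at hy ⊢
  obtain ⟨i, hi, hyi⟩ := hy
  by_cases hik : i = k
  · subst hik
    rcases lt_or_ge y x with hyx | hyx
    · exact ⟨l, Finset.mem_erase.2 ⟨Ne.symm hkl.1, (hmem hl).1⟩,
        (hl' i hk).trans_lt hyi.1, hyx.trans (hmem hl).2.2⟩
    · exact ⟨r, Finset.mem_erase.2 ⟨Ne.symm hkl.2, (hmem hr).1⟩,
        (hmem hr).2.1.trans_le hyx, hyi.2.trans_le (hr' i hk)⟩
  · exact ⟨i, Finset.mem_erase.2 ⟨hik, hi⟩, hyi⟩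

/-- The uncentred maximal function on the line of a `[0, ∞]`-valued function. -/
noncomputable def intervalMaximal (g : ℝ → ℝ≥0∞) (x : ℝ) : ℝ≥0∞ :=
  ⨆ (a : ℝ) (b : ℝ) (_ : a < x ∧ x < b), (ENNReal.ofReal (b - a))⁻¹ * ∫⁻ y in Set.Icc a b, g y

theorem lt_intervalMaximal_iff {g : ℝ → ℝ≥0∞} {x : ℝ} {t : ℝ≥0∞} :
    t < intervalMaximal g x ↔ ∃ a b, x ∈ Set.Ioo a b ∧
      t < (ENNReal.ofReal (b - a))⁻¹ * ∫⁻ y in Set.Icc a b, g y := by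
  simp only [intervalMaximal, lt_iSup_iff, exists_prop, Set.mem_Ioo]

theorem isOpen_lt_intervalMaximal (g : ℝ → ℝ≥0∞) (t : ℝ≥0∞) :
    IsOpen {x | t < intervalMaximal g x} := by
  rw [isOpen_iff_forall_mem_open]
  intro x hx
  obtain ⟨a, b, hxab, h⟩ := lt_intervalMaximal_iff.1 hx
  exact ⟨Set.Ioo a b, fun y hy => lt_intervalMaximal_iff.2 ⟨a, b, hy, h⟩, isOpen_Ioo, hxab⟩

theorem measurable_intervalMaximal (g : ℝ → ℝ≥0∞) : Measurable (intervalMaximal g) :=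
  measurable_of_Ioi fun t => (isOpen_lt_intervalMaximal g t).measurableSet

/-- The weak type inequality for a finite union of intervals. -/
theorem mul_measure_biUnion_add_le {ι : Type*} (s : Finset ι) (a b : ι → ℝ) {g : ℝ → ℝ≥0∞}
    (hg : Measurable g) (hfin : ∫⁻ y, g y ≠ ∞) {t : ℝ≥0∞}
    (h : ∀ i ∈ s, t * volume (Set.Ioo (a i) (b i)) ≤ ∫⁻ y in Set.Ioo (a i) (b i), g y) :
    t * volume (⋃ i ∈ s, Set.Ioo (a i) (b i)) + t * volume {x | t < g x} ≤
      (∫⁻ y in ⋃ i ∈ s, Set.Ioo (a i) (b i), g y) + ∫⁻ y in {x | t < g x}, g y := by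
  classical
  obtain ⟨u, hus, hunion, hover⟩ := exists_subfamily_overlap_le_two s a b
  rw [← hunion]
  set A := ⋃ i ∈ u, Set.Ioo (a i) (b i) with hA
  set P := {x | t < g x} with hP
  have hAm : MeasurableSet A :=
    u.measurableSet_biUnion fun i _ => measurableSet_Ioo
  have hPm : MeasurableSet P := measurableSet_lt measurable_const hg
  -- w is the overlap multiplicity, with values in {0, 1, 2}; summing the hypothesis over the
  -- subfamily gives ∫ t w ≤ ∫ w g.
  set w : ℝ → ℝ≥0∞ := fun x => ((u.filter fun i => x ∈ Set.Ioo (a i) (b i)).card : ℝ≥0∞) with hw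
  have hw_eq : ∀ x, w x = ∑ i ∈ u, (Set.Ioo (a i) (b i)).indicator 1 x := by
    intro x
    simp only [hw, Finset.card_filter, Set.indicator_apply, Nat.cast_sum, Pi.one_apply]
    refine Finset.sum_congr rfl fun i _ => ?_
    split_ifs <;> simp
  have hwm : Measurable w := by
    have : w = fun x => ∑ i ∈ u, (Set.Ioo (a i) (b i)).indicator (1 : ℝ → ℝ≥0∞) x := funext hw_eq
    rw [this]
    exact Finset.measurable_sum _ fun i _ => measurable_one.indicator measurableSet_Ioo
  have hwg : ∫⁻ x, w x * g x = ∑ i ∈ u, ∫⁻ y in Set.Ioo (a i) (b i), g y := by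
    simp_rw [hw_eq, Finset.sum_mul]
    rw [lintegral_finsetSum _ fun i _ => by
      exact (measurable_one.indicator measurableSet_Ioo).mul hg]
    refine Finset.sum_congr rfl fun i _ => ?_
    rw [← lintegral_indicator measurableSet_Ioo]
    refine lintegral_congr fun x => ?_
    by_cases hx : x ∈ Set.Ioo (a i) (b i) <;> simp [hx]
  have hwt : ∫⁻ x, t * w x = ∑ i ∈ u, t * volume (Set.Ioo (a i) (b i)) := by
    rw [lintegral_const_mul _ hwm]
    simp_rw [hw_eq]
    rw [lintegral_finsetSum _ fun i _ => measurable_one.indicator measurableSet_Ioo,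
      Finset.mul_sum]
    refine Finset.sum_congr rfl fun i _ => ?_
    rw [lintegral_indicator_one measurableSet_Ioo]
  have hle : ∫⁻ x, t * w x ≤ ∫⁻ x, w x * g x := by
    rw [hwg, hwt]; exact Finset.sum_le_sum fun i hi => h i (hus hi)
  have hwfin : ∫⁻ x, w x * g x ≠ ∞ := by
    refine ne_top_of_le_ne_top (ENNReal.mul_ne_top (a := 2) (by simp) hfin) ?_
    rw [← lintegral_const_mul _ hg]
    refine lintegral_mono fun x => mul_le_mul_left ?_ _
    simp only [hw]
    exact_mod_cast hover x
  -- In subtractive form this says (w - 1_A)(g - t) ≤ 1_P (g - t) = (g - t)⁺, which holds since w -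
  -- 1_A is 0 or 1. It is stated additively to avoid truncated subtraction.
  have hpt : ∀ x, A.indicator (fun _ => t) x + P.indicator (fun _ => t) x + w x * g x ≤
      A.indicator g x + P.indicator g x + t * w x := by
    intro x
    have hxA : x ∈ A ↔ (u.filter fun i => x ∈ Set.Ioo (a i) (b i)).card ≠ 0 := by
      rw [Finset.card_ne_zero]
      simp only [hA, Finset.Nonempty, Set.mem_iUnion, Finset.mem_filter, exists_prop]
    have hx2 := hover x
    have hxP : x ∈ P ↔ t < g x := Iff.rfl
    simp only [hw]
    generalize (u.filter fun i => x ∈ Set.Ioo (a i) (b i)).card = k at *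
    interval_cases k
    · have : x ∉ A := by simp [hxA]
      by_cases hp : x ∈ P
      · simp [this, hp, (hxP.1 hp).le]
      · simp [this, hp]
    · have : x ∈ A := by simp [hxA]
      by_cases hp : x ∈ P
      · simp only [this, hp, Set.indicator_of_mem, Nat.cast_one, one_mul, mul_one]
        have := (hxP.1 hp).le
        calc t + t + g x ≤ t + g x + g x := by gcongr
          _ = g x + g x + t := by ring
      · simp [this, hp, add_comm]
    · have : x ∈ A := by simp [hxA]
      by_cases hp : x ∈ P
      · simp only [this, hp, Set.indicator_of_mem, Nat.cast_ofNat]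
        exact le_of_eq (by ring)
      · simp only [this, hp, Set.indicator_of_mem, Nat.cast_ofNat, not_false_eq_true,
          Set.indicator_of_notMem, add_zero]
        have : g x ≤ t := not_lt.1 fun hh => hp (hxP.2 hh)
        calc t + 2 * g x = t + g x + g x := by ring
          _ ≤ t + g x + t := by gcongr
          _ = g x + t * 2 := by ring
  have hwgm : Measurable fun x => w x * g x := hwm.mul hg
  have hsum := lintegral_mono (μ := volume) hpt
  rw [lintegral_add_right _ hwgm, lintegral_add_right _ (measurable_const.indicator hPm),
    lintegral_add_right _ (hwm.const_mul t), lintegral_add_right _ (hg.indicator hPm),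
    lintegral_indicator_const hAm, lintegral_indicator_const hPm, lintegral_indicator hAm,
    lintegral_indicator hPm] at hsum
  exact (ENNReal.add_le_add_iff_right hwfin).1 (hsum.trans (add_le_add_right hle _))

/-- The sharp weak type inequality for the uncentred maximal function on the line. -/
theorem mul_measure_lt_intervalMaximal_add_le {g : ℝ → ℝ≥0∞}
    (hg : Measurable g) (hfin : ∫⁻ y, g y ≠ ∞) (t : ℝ≥0∞) :
    t * volume {x | t < intervalMaximal g x} + t * volume {x | t < g x} ≤
      (∫⁻ y in {x | t < intervalMaximal g x}, g y) + ∫⁻ y in {x | t < g x}, g y := by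
  -- Inner regularity reduces to compact K, which finitely many admissible intervals cover.
  rw [(isOpen_lt_intervalMaximal g t).measure_eq_iSup_isCompact, ENNReal.mul_iSup,
    ENNReal.iSup_add]
  refine iSup_le fun K => ?_
  -- A supremum over a false condition is 0, so for sets K that are not compact or not contained in
  -- the level set only this half remains to be shown.
  have hP : t * volume {x | t < g x} ≤ ∫⁻ y in {x | t < g x}, g y := by
    rw [← setLIntegral_const]
    exact setLIntegral_mono hg fun x hx => le_of_lt hx
  by_cases hK : K ⊆ {x | t < intervalMaximal g x}
  swap
  · simpa [hK] using le_add_left hP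
  by_cases hKc : IsCompact K
  swap
  · simpa [hKc] using le_add_left hP
  simp only [hK, hKc, iSup_pos]
  choose! a b hab hlt using fun x (hx : x ∈ K) => lt_intervalMaximal_iff.1 (hK hx)
  obtain ⟨s, hsK, hs⟩ := hKc.elim_nhds_subcover (fun x => Set.Ioo (a x) (b x))
    fun x hx => Ioo_mem_nhds (hab x hx).1 (hab x hx).2
  have key := mul_measure_biUnion_add_le s a b hg hfin (by
    intro x hx
    replace hx := hsK x hx
    have h := (hlt x hx).le
    have hpos : 0 < b x - a x := by linarith [(hab x hx).1, (hab x hx).2]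
    rw [Real.volume_Ioo, setLIntegral_congr Ioo_ae_eq_Icc]
    calc t * ENNReal.ofReal (b x - a x)
        ≤ (ENNReal.ofReal (b x - a x))⁻¹ * (∫⁻ y in Set.Icc (a x) (b x), g y) *
          ENNReal.ofReal (b x - a x) := by gcongr
      _ = _ := by
        rw [mul_comm, ← mul_assoc, ENNReal.mul_inv_cancel (by simpa using hpos)
          ENNReal.ofReal_ne_top, one_mul])
  refine le_trans ?_ (key.trans ?_)
  · gcongr
  · gcongr
    refine Set.iUnion₂_subset fun x hx y hy => ?_
    exact lt_intervalMaximal_iff.2 ⟨_, _, hy, hlt x (hsK x hx)⟩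

theorem intervalMaximal_le_const {g : ℝ → ℝ≥0∞} {K : ℝ≥0∞} (hK : ∀ x, g x ≤ K) (x : ℝ) :
    intervalMaximal g x ≤ K := by
  refine iSup_le fun a => iSup_le fun b => iSup_le fun h => ?_
  have hpos : 0 < b - a := by linarith [h.1, h.2]
  calc (ENNReal.ofReal (b - a))⁻¹ * ∫⁻ y in Set.Icc a b, g y
      ≤ (ENNReal.ofReal (b - a))⁻¹ * ∫⁻ _ in Set.Icc a b, K := by
        gcongr; exact hK _
    _ = K := by
      rw [setLIntegral_const, Real.volume_Icc, mul_comm, mul_assoc,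
        ENNReal.mul_inv_cancel (by simpa using hpos) ENNReal.ofReal_ne_top, mul_one]

/-! ### From weak type to the sharp bound on the line. -/

/-- The layer cake formula for `[0, ∞)`-valued functions. -/
theorem lintegral_ennreal_rpow_eq_lintegral_meas_lt_mul {α : Type*} [MeasurableSpace α]
    (μ : Measure α) {h : α → ℝ≥0∞} (hh : Measurable h) (hfin : ∀ x, h x ≠ ∞) {r : ℝ} (hr : 0 < r) :
    ∫⁻ x, h x ^ r ∂μ = ENNReal.ofReal r *
      ∫⁻ t in Set.Ioi (0 : ℝ), μ {x | ENNReal.ofReal t < h x} * ENNReal.ofReal (t ^ (r - 1)) := by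
  have := lintegral_rpow_eq_lintegral_meas_lt_mul μ (f := fun x => (h x).toReal)
    (Filter.Eventually.of_forall fun x => ENNReal.toReal_nonneg) hh.ennreal_toReal.aemeasurable hr
  convert this using 1
  · refine lintegral_congr fun x => ?_
    rw [← ENNReal.ofReal_rpow_of_nonneg ENNReal.toReal_nonneg hr.le,
      ENNReal.ofReal_toReal (hfin x)]
  · congr 1
    refine setLIntegral_congr_fun measurableSet_Ioi fun t ht => ?_
    congr 2
    ext x
    exact ENNReal.ofReal_lt_iff_lt_toReal (le_of_lt ht) (hfin x)

theorem measurable_meas_lt_mul {α : Type*} [MeasurableSpace α] (μ : Measure α) (h : α → ℝ≥0∞)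
    (r : ℝ) :
    Measurable fun t : ℝ => μ {x | ENNReal.ofReal t < h x} * ENNReal.ofReal (t ^ r) := by
  refine Measurable.mul ?_ (by fun_prop)
  refine Antitone.measurable fun s t hst => measure_mono fun x hx => ?_
  exact (ENNReal.ofReal_le_ofReal hst).trans_lt hx

/-- The sharp weak type inequality integrated over all levels. -/
theorem mul_lintegral_intervalMaximal_rpow_add_le {g : ℝ → ℝ≥0∞} (hg : Measurable g)
    {K : ℝ≥0∞} (hK : ∀ x, g x ≤ K) (hKfin : K ≠ ∞) (hfin : ∫⁻ y, g y ≠ ∞) {p : ℝ} (hp : 1 < p) :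
    ENNReal.ofReal (p - 1) * ((∫⁻ x, intervalMaximal g x ^ p) + ∫⁻ x, g x ^ p) ≤
      ENNReal.ofReal p * ((∫⁻ x, g x * intervalMaximal g x ^ (p - 1)) + ∫⁻ x, g x ^ p) := by
  have hM := measurable_intervalMaximal g
  have hgf : ∀ x, g x ≠ ∞ := fun x => ne_top_of_le_ne_top hKfin (hK x)
  have hMf : ∀ x, intervalMaximal g x ≠ ∞ := fun x =>
    ne_top_of_le_ne_top hKfin (intervalMaximal_le_const hK x)
  have hp0 : 0 < p := by linarith
  have hp1 : 0 < p - 1 := by linarith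
  -- With respect to g dx, both integrals on the right are layer cakes of exponent p - 1.
  set ν := (volume : Measure ℝ).withDensity g with hν
  have hYM : ∫⁻ x, g x * intervalMaximal g x ^ (p - 1) = ∫⁻ x, intervalMaximal g x ^ (p - 1) ∂ν := by
    rw [hν, lintegral_withDensity_eq_lintegral_mul _ hg (hM.pow_const _)]; rfl
  have hYg : ∫⁻ x, g x ^ p = ∫⁻ x, g x ^ (p - 1) ∂ν := by
    rw [hν, lintegral_withDensity_eq_lintegral_mul _ hg (hg.pow_const _)]
    refine lintegral_congr fun x => ?_
    conv_lhs => rw [show p = 1 + (p - 1) by ring,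
      ENNReal.rpow_add_of_nonneg _ _ zero_le_one hp1.le, ENNReal.rpow_one]
    rfl
  have hleft : (∫⁻ x, intervalMaximal g x ^ p) + ∫⁻ x, g x ^ p = ENNReal.ofReal p *
      ∫⁻ t in Set.Ioi (0 : ℝ), (volume {x | ENNReal.ofReal t < intervalMaximal g x} *
        ENNReal.ofReal (t ^ (p - 1)) + volume {x | ENNReal.ofReal t < g x} *
        ENNReal.ofReal (t ^ (p - 1))) := by
    rw [lintegral_add_left (measurable_meas_lt_mul _ _ _), mul_add,
      lintegral_ennreal_rpow_eq_lintegral_meas_lt_mul _ hM hMf hp0,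
      lintegral_ennreal_rpow_eq_lintegral_meas_lt_mul _ hg hgf hp0]
  have hright : (∫⁻ x, g x * intervalMaximal g x ^ (p - 1)) + ∫⁻ x, g x ^ p =
      ENNReal.ofReal (p - 1) *
      ∫⁻ t in Set.Ioi (0 : ℝ), (ν {x | ENNReal.ofReal t < intervalMaximal g x} *
        ENNReal.ofReal (t ^ (p - 1 - 1)) + ν {x | ENNReal.ofReal t < g x} *
        ENNReal.ofReal (t ^ (p - 1 - 1))) := by
    rw [lintegral_add_left (measurable_meas_lt_mul _ _ _), mul_add, hYM, hYg,
      lintegral_ennreal_rpow_eq_lintegral_meas_lt_mul _ hM hMf hp1,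
      lintegral_ennreal_rpow_eq_lintegral_meas_lt_mul _ hg hgf hp1]
  rw [hleft, hright, ← mul_assoc, ← mul_assoc, mul_comm (ENNReal.ofReal p)]
  refine mul_le_mul_right (setLIntegral_mono' measurableSet_Ioi fun t ht => ?_) _
  have ht0 : (0 : ℝ) < t := ht
  have hpow : ENNReal.ofReal (t ^ (p - 1)) =
      ENNReal.ofReal t * ENNReal.ofReal (t ^ (p - 1 - 1)) := by
    rw [← ENNReal.ofReal_mul ht0.le, mul_comm t, ← Real.rpow_add_one ht0.ne']
    congr 2; ring
  rw [← add_mul, ← add_mul, hpow, ← mul_assoc]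
  refine mul_le_mul_left ?_ _
  rw [hν, withDensity_apply _ (measurableSet_lt measurable_const hM),
    withDensity_apply _ (measurableSet_lt measurable_const hg), mul_comm, mul_add]
  exact mul_measure_lt_intervalMaximal_add_le hg hfin _

/-- Young's inequality, with equality for `b = c * a`. -/
theorem mul_rpow_le_weighted {p c : ℝ} (hp : 1 < p) (hc : 0 < c) {a b : ℝ} (ha : 0 ≤ a)
    (hb : 0 ≤ b) : a * b ^ (p - 1) ≤ c ^ (p - 1) / p * a ^ p + (p - 1) / (p * c) * b ^ p := by
  have hp0 : 0 < p := by linarith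
  have hp1 : 0 < p - 1 := by linarith
  have hpq : p.HolderConjugate (p / (p - 1)) := Real.HolderConjugate.conjExponent hp
  -- The scalings are mutually inverse, so the product is unchanged, while equality in Young's
  -- inequality moves to `b = c * a`.
  have h := Real.young_inequality_of_nonneg (a := c ^ ((p - 1) / p) * a)
    (b := c ^ (-((p - 1) / p)) * b ^ (p - 1)) (by positivity) (by positivity) hpq
  have h1 : c ^ ((p - 1) / p) * a * (c ^ (-((p - 1) / p)) * b ^ (p - 1)) = a * b ^ (p - 1) := by
    rw [Real.rpow_neg hc.le]
    have : c ^ ((p - 1) / p) ≠ 0 := by positivity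
    field_simp
  have h2 : (c ^ ((p - 1) / p) * a) ^ p = c ^ (p - 1) * a ^ p := by
    rw [Real.mul_rpow (by positivity) ha, ← Real.rpow_mul hc.le, div_mul_cancel₀ _ hp0.ne']
  have h3 : (c ^ (-((p - 1) / p)) * b ^ (p - 1)) ^ (p / (p - 1)) = c⁻¹ * b ^ p := by
    rw [Real.mul_rpow (by positivity) (by positivity), ← Real.rpow_mul hc.le,
      ← Real.rpow_mul hb]
    congr 1
    · rw [← Real.rpow_neg_one]; congr 1; field_simp
    · congr 1; field_simp
  rw [h1, h2, h3] at h
  refine h.trans (le_of_eq ?_)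
  field_simp

theorem ennreal_mul_rpow_le_weighted {p c : ℝ} (hp : 1 < p) (hc : 0 < c) {a b : ℝ≥0∞}
    (ha : a ≠ ∞) (hb : b ≠ ∞) : a * b ^ (p - 1) ≤
      ENNReal.ofReal (c ^ (p - 1) / p) * a ^ p + ENNReal.ofReal ((p - 1) / (p * c)) * b ^ p := by
  have hp0 : 0 < p := by linarith
  have hp1 : 0 < p - 1 := by linarith
  lift a to NNReal using ha
  lift b to NNReal using hb
  have := ENNReal.ofReal_le_ofReal (mul_rpow_le_weighted hp hc a.2 b.2)
  have hcp : 0 ≤ c ^ (p - 1) / p := by positivity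
  have hcp' : 0 ≤ (p - 1) / (p * c) := by positivity
  rw [ENNReal.ofReal_add (mul_nonneg hcp (Real.rpow_nonneg a.2 _))
      (mul_nonneg hcp' (Real.rpow_nonneg b.2 _)), ENNReal.ofReal_mul hcp,
    ENNReal.ofReal_mul hcp', ENNReal.ofReal_mul a.2,
    ← ENNReal.ofReal_rpow_of_nonneg b.2 hp1.le, ← ENNReal.ofReal_rpow_of_nonneg b.2 hp0.le,
    ← ENNReal.ofReal_rpow_of_nonneg a.2 hp0.le] at this
  simpa using this

/-- With X = ∫ (M g)^p and F = ∫ g^p, the integrated weak type inequality and Young's inequality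
give (p - 1)(1 - 1/c) X ≤ (1 + c^(p-1)) F, and the equation for c turns the right side into (p -
1)(1 - 1/c) c^p F. Boundedness and integrability of g supply the finiteness needed to absorb X. -/
theorem lintegral_intervalMaximal_rpow_le_of_bounded {g : ℝ → ℝ≥0∞} (hg : Measurable g)
    {K : ℝ≥0∞} (hK : ∀ x, g x ≤ K) (hKfin : K ≠ ∞) (hfin : ∫⁻ y, g y ≠ ∞) {p c : ℝ} (hp : 1 < p)
    (hc : 0 < c) (hroot : (p - 1) * c ^ p - p * c ^ (p - 1) - 1 = 0) :
    ∫⁻ x, intervalMaximal g x ^ p ≤ ENNReal.ofReal (c ^ p) * ∫⁻ x, g x ^ p := by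
  have hM := measurable_intervalMaximal g
  have hp0 : 0 < p := by linarith
  have hp1 : 0 < p - 1 := by linarith
  have hgf : ∀ x, g x ≠ ∞ := fun x => ne_top_of_le_ne_top hKfin (hK x)
  have hMf : ∀ x, intervalMaximal g x ≠ ∞ := fun x =>
    ne_top_of_le_ne_top hKfin (intervalMaximal_le_const hK x)
  have hmain := mul_lintegral_intervalMaximal_rpow_add_le hg hK hKfin hfin hp
  have hKp : (∫⁻ x, g x) * K ^ (p - 1) ≠ ∞ :=
    ENNReal.mul_ne_top hfin (ENNReal.rpow_ne_top_of_nonneg hp1.le hKfin)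
  have hYfin : ∫⁻ x, g x * intervalMaximal g x ^ (p - 1) ≠ ∞ := by
    refine ne_top_of_le_ne_top hKp ?_
    rw [← lintegral_mul_const _ hg]
    refine lintegral_mono fun x => ?_
    gcongr
    exact intervalMaximal_le_const hK x
  have hFfin : ∫⁻ x, g x ^ p ≠ ∞ := by
    refine ne_top_of_le_ne_top hKp ?_
    rw [← lintegral_mul_const _ hg]
    refine lintegral_mono fun x => ?_
    conv_lhs => rw [show p = 1 + (p - 1) by ring,
      ENNReal.rpow_add_of_nonneg _ _ zero_le_one hp1.le, ENNReal.rpow_one]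
    gcongr
    exact hK x
  have hyoung : ∫⁻ x, g x * intervalMaximal g x ^ (p - 1) ≤
      ENNReal.ofReal (c ^ (p - 1) / p) * (∫⁻ x, g x ^ p) +
        ENNReal.ofReal ((p - 1) / (p * c)) * ∫⁻ x, intervalMaximal g x ^ p := by
    rw [← lintegral_const_mul _ (hg.pow_const _), ← lintegral_const_mul _ (hM.pow_const _),
      ← lintegral_add_left ((hg.pow_const _).const_mul _)]
    exact lintegral_mono fun x => ennreal_mul_rpow_le_weighted hp hc (hgf x) (hMf x)
  generalize (∫⁻ x, g x * intervalMaximal g x ^ (p - 1)) = Y at *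
  generalize (∫⁻ x, g x ^ p) = F at *
  generalize (∫⁻ x, intervalMaximal g x ^ p) = X at *
  -- The right side of `hmain` is finite, which forces X to be finite.
  have hXfin : X ≠ ∞ := by
    rintro rfl
    have h1 : ENNReal.ofReal (p - 1) * (∞ + F) = ∞ := by
      rw [top_add, ENNReal.mul_top]; simpa using hp
    rw [h1, top_le_iff] at hmain
    exact ENNReal.mul_ne_top ENNReal.ofReal_ne_top (ENNReal.add_ne_top.2 ⟨hYfin, hFfin⟩) hmain
  lift X to NNReal using hXfin
  lift F to NNReal using hFfin
  lift Y to NNReal using hYfin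
  have hc1 : 1 < c := one_lt_of_root hp hc hroot
  have e1 : (p - 1) * ((X : ℝ) + F) ≤ p * (Y + F) := by
    have := ENNReal.toReal_mono (by finiteness) hmain
    simpa [ENNReal.toReal_mul, hp1.le, hp0.le, ENNReal.toReal_add] using this
  have e2 : (Y : ℝ) ≤ c ^ (p - 1) / p * F + (p - 1) / (p * c) * X := by
    have := ENNReal.toReal_mono (by finiteness) hyoung
    rw [ENNReal.toReal_add (by finiteness) (by finiteness), ENNReal.toReal_mul, ENNReal.toReal_mul,
      ENNReal.toReal_ofReal (by positivity), ENNReal.toReal_ofReal (by positivity)] at this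
    simpa using this
  have e3 : (X : ℝ) ≤ c ^ p * F := by
    have hcp : c ^ p = c ^ (p - 1) * c := by
      rw [← Real.rpow_add_one hc.ne']; congr 1; ring
    rw [hcp] at hroot ⊢
    generalize c ^ (p - 1) = d at *
    have e4 : p * (Y : ℝ) ≤ d * F + (p - 1) / c * X := by
      calc p * (Y : ℝ) ≤ p * (d / p * F + (p - 1) / (p * c) * X) := by gcongr
        _ = _ := by field_simp
    have e5 : (p - 1) * (1 - 1 / c) * X ≤ (1 + d) * F := by
      have : (p - 1) * (1 - 1 / c) * (X : ℝ) = (p - 1) * X - (p - 1) / c * X := by ring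
      rw [this]; linarith
    have e6 : (1 + d) * (F : ℝ) = (p - 1) * (1 - 1 / c) * (d * c * F) := by
      have : (p - 1) * (1 - 1 / c) * (d * c * F) = ((p - 1) * (d * c) - (p - 1) * d) * F := by
        field_simp
      rw [this, show (p - 1) * (d * c) = p * d + 1 by linarith]; ring
    rw [e6] at e5
    refine le_of_mul_le_mul_left e5 (mul_pos hp1 ?_)
    rw [sub_pos, div_lt_one hc]; exact hc1
  have := ENNReal.ofReal_le_ofReal e3
  rw [ENNReal.ofReal_mul (by positivity)] at this
  simpa using this

theorem intervalMaximal_mono {g h : ℝ → ℝ≥0∞} (hgh : ∀ x, g x ≤ h x) (x : ℝ) :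
    intervalMaximal g x ≤ intervalMaximal h x := by
  unfold intervalMaximal
  gcongr
  exact hgh _

theorem intervalMaximal_iSup {g : ℕ → ℝ → ℝ≥0∞} (hg : ∀ k, Measurable (g k)) (hmono : Monotone g)
    (x : ℝ) : intervalMaximal (fun y => ⨆ k, g k y) x = ⨆ k, intervalMaximal (g k) x := by
  refine le_antisymm ?_ (iSup_le fun k => intervalMaximal_mono (fun y => le_iSup (g · y) k) x)
  refine iSup_le fun a => iSup_le fun b => iSup_le fun h => ?_
  rw [lintegral_iSup hg hmono, ENNReal.mul_iSup]
  refine iSup_mono fun k => ?_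
  exact le_iSup_of_le a (le_iSup_of_le b (le_iSup_of_le h le_rfl))

/-- The sharp `L^p` bound for the uncentred maximal function on the line. -/
theorem lintegral_intervalMaximal_rpow_le {g : ℝ → ℝ≥0∞} (hg : Measurable g)
    {p c : ℝ} (hp : 1 < p)
    (hc : 0 < c) (hroot : (p - 1) * c ^ p - p * c ^ (p - 1) - 1 = 0) :
    ∫⁻ x, intervalMaximal g x ^ p ≤ ENNReal.ofReal (c ^ p) * ∫⁻ x, g x ^ p := by
  have hp0 : 0 < p := by linarith
  -- Truncating both height and support yields bounded integrable functions increasing to g;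
  -- monotone convergence then passes the bound to g.
  set h : ℕ → ℝ → ℝ≥0∞ := fun k =>
    (Set.Icc (-(k : ℝ)) k).indicator fun x => min (g x) k with hh
  have hhm : ∀ k, Measurable (h k) := fun k =>
    (hg.min measurable_const).indicator measurableSet_Icc
  have hmono : Monotone h := by
    intro k l hkl x
    have hkl' : (k : ℝ) ≤ l := by exact_mod_cast hkl
    simp only [hh]
    calc (Set.Icc (-(k : ℝ)) k).indicator (fun x => min (g x) k) x
        ≤ (Set.Icc (-(l : ℝ)) l).indicator (fun x => min (g x) k) x :=
          Set.indicator_le_indicator_of_subset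
            (Set.Icc_subset_Icc (by linarith) hkl') (fun _ => zero_le) x
      _ ≤ (Set.Icc (-(l : ℝ)) l).indicator (fun x => min (g x) l) x := by
          refine Set.indicator_le_indicator ?_
          gcongr
  have hle : ∀ k x, h k x ≤ g x := fun k x =>
    (Set.indicator_le_self _ _ x).trans (min_le_left _ _)
  have hsup : ∀ x, ⨆ k, h k x = g x := by
    intro x
    refine le_antisymm (iSup_le fun k => hle k x) (le_of_forall_lt fun d hd => ?_)
    obtain ⟨k, hk⟩ := ENNReal.exists_nat_gt hd.ne_top
    obtain ⟨l, hl⟩ := exists_nat_ge |x|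
    refine lt_of_lt_of_le ?_ (le_iSup (h · x) (max k l))
    have hx : x ∈ Set.Icc (-((max k l : ℕ) : ℝ)) ((max k l : ℕ) : ℝ) := by
      rw [Set.mem_Icc, ← abs_le]
      exact hl.trans (by exact_mod_cast le_max_right k l)
    simp only [hh, Set.indicator_of_mem hx]
    exact lt_min hd (hk.trans_le (by exact_mod_cast le_max_left k l))
  have hgsup : g = fun x => ⨆ k, h k x := funext fun x => (hsup x).symm
  have hpow : ∀ x, intervalMaximal g x ^ p = ⨆ k, intervalMaximal (h k) x ^ p := by
    intro x
    conv_lhs => rw [hgsup]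
    rw [intervalMaximal_iSup hhm hmono]
    exact (ENNReal.orderIsoRpow p hp0).map_iSup _
  simp_rw [hpow]
  rw [lintegral_iSup (fun k => (measurable_intervalMaximal _).pow_const _) (by
    intro k l hkl x
    exact ENNReal.rpow_le_rpow (intervalMaximal_mono (hmono hkl) x) hp0.le)]
  refine iSup_le fun k => ?_
  have hbd : ∀ x, h k x ≤ (k : ℝ≥0∞) := by
    intro x
    exact (Set.indicator_le_self _ _ x).trans (min_le_right _ _)
  have hkint : ∫⁻ x, h k x ≠ ∞ := by
    refine ne_top_of_le_ne_top (b := (k : ℝ≥0∞) * volume (Set.Icc (-(k : ℝ)) k)) (by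
      rw [Real.volume_Icc]; finiteness) ?_
    rw [← setLIntegral_const, ← lintegral_indicator measurableSet_Icc]
    refine lintegral_mono fun x => Set.indicator_le_indicator (min_le_right _ _)
  refine (lintegral_intervalMaximal_rpow_le_of_bounded (hhm k) hbd (by simp) hkint hp hc
    hroot).trans ?_
  gcongr
  exact hle k _

/-! ### Several variables: iterating the one-dimensional bound. -/

/-- Slightly enlarging an interval to rational endpoints does not decrease the integral and barely
changes the length. The countable supremum yields the joint measurability required by Tonelli. -/
theorem intervalMaximal_eq_iSup_rat (g : ℝ → ℝ≥0∞) (x : ℝ) :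
    intervalMaximal g x = ⨆ (q : ℚ) (r : ℚ) (_ : (q : ℝ) < x ∧ x < r),
      (ENNReal.ofReal (r - q))⁻¹ * ∫⁻ y in Set.Icc (q : ℝ) r, g y := by
  refine le_antisymm (le_of_forall_lt fun d hd => ?_) ?_
  · obtain ⟨a, b, hx, hlt⟩ := lt_intervalMaximal_iff.1 hd
    have hpos : 0 < b - a := by linarith [hx.1, hx.2]
    have hcont : Filter.Tendsto
        (fun u => (ENNReal.ofReal u)⁻¹ * ∫⁻ y in Set.Icc a b, g y) (nhds (b - a))
        (nhds ((ENNReal.ofReal (b - a))⁻¹ * ∫⁻ y in Set.Icc a b, g y)) := by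
      refine ENNReal.Tendsto.mul_const ?_ (Or.inl (by simp))
      exact (continuous_inv.comp ENNReal.continuous_ofReal).tendsto _
    obtain ⟨δ, hδ, hball⟩ := Metric.eventually_nhds_iff.1 (hcont.eventually_const_lt hlt)
    obtain ⟨q, hq, hqa⟩ := exists_rat_btwn (show a - δ / 2 < a by linarith)
    obtain ⟨r, hbr, hr⟩ := exists_rat_btwn (show b < b + δ / 2 by linarith)
    have h := hball (y := (r : ℝ) - q) (by
      rw [Real.dist_eq, abs_lt]; constructor <;> linarith)
    refine h.trans_le (le_iSup_of_le q (le_iSup_of_le r (le_iSup_of_le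
      ⟨hqa.trans hx.1, hx.2.trans hbr⟩ ?_)))
    gcongr
  · refine iSup_le fun q => iSup_le fun r => iSup_le fun h => ?_
    exact le_iSup_of_le (q : ℝ) (le_iSup_of_le (r : ℝ) (le_iSup_of_le h le_rfl))

theorem measurable_intervalMaximal_prod {β : Type*} [MeasurableSpace β] {g : ℝ × β → ℝ≥0∞}
    (hg : Measurable g) :
    Measurable fun z : ℝ × β => intervalMaximal (fun t => g (t, z.2)) z.1 := by
  simp_rw [intervalMaximal_eq_iSup_rat]
  refine Measurable.iSup fun q => Measurable.iSup fun r => ?_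
  have hF : Measurable fun z : ℝ × β =>
      (ENNReal.ofReal ((r : ℝ) - q))⁻¹ * ∫⁻ y in Set.Icc (q : ℝ) r, g (y, z.2) := by
    refine Measurable.const_mul ?_ _
    exact (hg.lintegral_prod_left' (μ := volume.restrict (Set.Icc (q : ℝ) r))).comp measurable_snd
  have hS : MeasurableSet {z : ℝ × β | (q : ℝ) < z.1 ∧ z.1 < r} :=
    (measurableSet_lt measurable_const measurable_fst).inter
      (measurableSet_lt measurable_fst measurable_const)
  convert hF.indicator hS using 1
  ext z
  by_cases hz : (q : ℝ) < z.1 ∧ z.1 < r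
  · rw [Set.indicator_of_mem (show z ∈ {z : ℝ × β | (q : ℝ) < z.1 ∧ z.1 < r} from hz)]
    simp [hz]
  · rw [Set.indicator_of_notMem (show z ∉ {z : ℝ × β | (q : ℝ) < z.1 ∧ z.1 < r} from hz)]
    simp only [hz, not_false_eq_true, iSup_neg, bot_eq_zero]

/-- The strong maximal function of a `[0, ∞]`-valued function. -/
noncomputable def boxMaximal {n : ℕ} (g : (Fin n → ℝ) → ℝ≥0∞) (x : Fin n → ℝ) : ℝ≥0∞ :=
  ⨆ (a : Fin n → ℝ) (b : Fin n → ℝ) (_ : ∀ i, a i < x i ∧ x i < b i),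
    (∏ i, ENNReal.ofReal (b i - a i))⁻¹ * ∫⁻ y in Set.Icc a b, g y

theorem strongMaximal_eq_boxMaximal {n : ℕ} {𝕜 : Type*} [RCLike 𝕜] (f : (Fin n → ℝ) → 𝕜) :
    strongMaximal f = boxMaximal fun y => ‖f y‖ₑ := rfl

theorem boxMaximal_congr_ae {n : ℕ} {g h : (Fin n → ℝ) → ℝ≥0∞} (hgh : g =ᵐ[volume] h) :
    boxMaximal g = boxMaximal h := by
  ext x
  unfold boxMaximal
  refine iSup_congr fun a => iSup_congr fun b => iSup_congr fun _ => ?_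
  rw [setLIntegral_congr_fun_ae measurableSet_Icc (hgh.mono fun y hy _ => hy)]

theorem measurable_boxMaximal {n : ℕ} (g : (Fin n → ℝ) → ℝ≥0∞) : Measurable (boxMaximal g) := by
  refine measurable_of_Ioi fun t => IsOpen.measurableSet ?_
  rw [isOpen_iff_forall_mem_open]
  intro x hx
  simp only [Set.mem_preimage, Set.mem_Ioi, boxMaximal, lt_iSup_iff, exists_prop] at hx
  obtain ⟨a, b, hab, hlt⟩ := hx
  refine ⟨Set.univ.pi fun i => Set.Ioo (a i) (b i), fun y hy => ?_,
    isOpen_set_pi Set.finite_univ fun _ _ => isOpen_Ioo, fun i _ => hab i⟩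
  simp only [Set.mem_preimage, Set.mem_Ioi, boxMaximal, lt_iSup_iff, exists_prop]
  exact ⟨a, b, fun i => hy i trivial, hlt⟩

theorem piFinSuccAbove_zero_symm_eq_cons {n : ℕ} (z : ℝ × (Fin n → ℝ)) :
    (MeasurableEquiv.piFinSuccAbove (fun _ : Fin (n + 1) => ℝ) 0).symm z =
      (Fin.cons z.1 z.2 : Fin (n + 1) → ℝ) := by
  simp [MeasurableEquiv.piFinSuccAbove_symm_apply, Fin.insertNthEquiv]

theorem measurable_comp_cons {n : ℕ} {g : (Fin (n + 1) → ℝ) → ℝ≥0∞} (hg : Measurable g) :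
    Measurable fun z : ℝ × (Fin n → ℝ) => g (Fin.cons z.1 z.2 : Fin (n + 1) → ℝ) := by
  simp_rw [← piFinSuccAbove_zero_symm_eq_cons]
  exact hg.comp (MeasurableEquiv.measurable _)

theorem lintegral_eq_lintegral_cons {n : ℕ} {g : (Fin (n + 1) → ℝ) → ℝ≥0∞} (hg : Measurable g) :
    ∫⁻ x, g x = ∫⁻ z : ℝ × (Fin n → ℝ), g (Fin.cons z.1 z.2 : Fin (n + 1) → ℝ) := by
  simp_rw [← piFinSuccAbove_zero_symm_eq_cons]
  exact ((volume_preserving_piFinSuccAbove (fun _ : Fin (n + 1) => ℝ) 0).symm.lintegral_comp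
    hg).symm

/-- The maximal function over boxes in `n + 1` variables is dominated by the composition of the
maximal functions in the first variable and in the last `n` variables. -/
theorem boxMaximal_cons_le {n : ℕ} {g : (Fin (n + 1) → ℝ) → ℝ≥0∞} (hg : Measurable g)
    (s : ℝ) (x : Fin n → ℝ) :
    boxMaximal g (Fin.cons s x : Fin (n + 1) → ℝ) ≤
      boxMaximal (fun y => intervalMaximal (fun t => g (Fin.cons t y : Fin (n + 1) → ℝ)) s) x := by
  refine iSup_le fun a => iSup_le fun b => iSup_le fun h => ?_
  have h0 : a 0 < s ∧ s < b 0 := by simpa using h 0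
  refine le_iSup_of_le (fun i => a i.succ) (le_iSup_of_le (fun i => b i.succ)
    (le_iSup_of_le (fun i => by simpa using h i.succ) ?_))
  have hpre : (MeasurableEquiv.piFinSuccAbove (fun _ : Fin (n + 1) => ℝ) 0).symm ⁻¹' Set.Icc a b =
      Set.Icc (a 0) (b 0) ×ˢ Set.Icc (fun i => a i.succ) (fun i => b i.succ) := by
    ext ⟨t, y⟩
    simp [MeasurableEquiv.piFinSuccAbove_symm_apply, Fin.insertNthEquiv, Pi.le_def,
      Fin.forall_fin_succ]
  have hgm := measurable_comp_cons hg
  have hicc : ∫⁻ y in Set.Icc a b, g y =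
      ∫⁻ y in Set.Icc (fun i => a i.succ) (fun i => b i.succ),
        ∫⁻ t in Set.Icc (a 0) (b 0), g (Fin.cons t y : Fin (n + 1) → ℝ) := by
    rw [← ((volume_preserving_piFinSuccAbove (fun _ : Fin (n + 1) => ℝ) 0).symm
      ).setLIntegral_comp_preimage_emb (MeasurableEquiv.measurableEmbedding _), hpre]
    simp_rw [piFinSuccAbove_zero_symm_eq_cons]
    exact setLIntegral_prod_symm _ hgm.aemeasurable
  rw [hicc, Fin.prod_univ_succ, ENNReal.mul_inv (Or.inr (ENNReal.prod_ne_top fun _ _ => ENNReal.ofReal_ne_top))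
    (Or.inl ENNReal.ofReal_ne_top), mul_comm (ENNReal.ofReal (b 0 - a 0))⁻¹, mul_assoc]
  refine mul_le_mul_right ?_ _
  have hne : (ENNReal.ofReal (b 0 - a 0))⁻¹ ≠ ∞ := by
    simpa using h0.1.trans h0.2
  rw [← lintegral_const_mul' _ _ hne]
  refine lintegral_mono fun y => ?_
  exact le_iSup_of_le (a 0) (le_iSup_of_le (b 0) (le_iSup_of_le h0 le_rfl))

/-- The `L^p` bound for the strong maximal function. -/
theorem lintegral_boxMaximal_rpow_le {p c : ℝ} (hp : 1 < p)
    (hc : 0 < c) (hroot : (p - 1) * c ^ p - p * c ^ (p - 1) - 1 = 0) (n : ℕ)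
    {g : (Fin n → ℝ) → ℝ≥0∞} (hg : Measurable g) :
    ∫⁻ x, boxMaximal g x ^ p ≤ ENNReal.ofReal (c ^ p) ^ n * ∫⁻ x, g x ^ p := by
  induction n with
  | zero =>
    -- For n = 0 the space is one point with Dirac measure and the empty product is 1, so every
    -- average of g is its value there.
    rw [pow_zero, one_mul]
    refine lintegral_mono fun x => ENNReal.rpow_le_rpow ?_ (by linarith)
    refine iSup_le fun a => iSup_le fun b => iSup_le fun h => ?_
    have : Set.Icc a b = Set.univ := by
      ext y; simp [Subsingleton.elim a y, Subsingleton.elim b y]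
    rw [this, Measure.restrict_univ, volume_pi, Measure.pi_of_empty _ x, lintegral_dirac' _ hg]
    simp
  | succ n ih =>
    have hgm := measurable_comp_cons hg
    have hMm : Measurable fun z : ℝ × (Fin n → ℝ) =>
        intervalMaximal (fun t => g (Fin.cons t z.2 : Fin (n + 1) → ℝ)) z.1 :=
      measurable_intervalMaximal_prod
        (g := fun z : ℝ × (Fin n → ℝ) => g (Fin.cons z.1 z.2 : Fin (n + 1) → ℝ)) hgm
    have hMs : ∀ s : ℝ, Measurable fun y : Fin n → ℝ =>
        intervalMaximal (fun t => g (Fin.cons t y : Fin (n + 1) → ℝ)) s :=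
      fun s => hMm.comp (f := fun y : Fin n → ℝ => (s, y)) measurable_prodMk_left
    have hgs : ∀ y : Fin n → ℝ, Measurable fun t : ℝ => g (Fin.cons t y : Fin (n + 1) → ℝ) :=
      fun y => hgm.comp (f := fun t : ℝ => (t, y)) measurable_prodMk_right
    have hBm := (measurable_boxMaximal g).pow_const p
    have hPm := hg.pow_const p
    rw [lintegral_eq_lintegral_cons hBm, lintegral_eq_lintegral_cons hPm]
    -- For fixed s the induction hypothesis applies to the one-variable maximal function taken at s,
    -- as a function of y; after swapping the integrals, the bound on the line applies for each
    -- fixed y.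
    calc ∫⁻ z : ℝ × (Fin n → ℝ), boxMaximal g (Fin.cons z.1 z.2 : Fin (n + 1) → ℝ) ^ p
        = ∫⁻ s : ℝ, ∫⁻ x : Fin n → ℝ, boxMaximal g (Fin.cons s x : Fin (n + 1) → ℝ) ^ p :=
          lintegral_prod _ (measurable_comp_cons hBm).aemeasurable
      _ ≤ ∫⁻ s : ℝ, ENNReal.ofReal (c ^ p) ^ n * ∫⁻ y : Fin n → ℝ,
          intervalMaximal (fun t => g (Fin.cons t y : Fin (n + 1) → ℝ)) s ^ p := by
        refine lintegral_mono fun s => le_trans (lintegral_mono fun x => ?_)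
          (ih (hMs s))
        exact ENNReal.rpow_le_rpow (boxMaximal_cons_le hg s x) (by linarith)
      _ = ENNReal.ofReal (c ^ p) ^ n * ∫⁻ y : Fin n → ℝ, ∫⁻ s : ℝ,
          intervalMaximal (fun t => g (Fin.cons t y : Fin (n + 1) → ℝ)) s ^ p := by
        rw [lintegral_const_mul' _ _ (by finiteness)]
        congr 1
        exact lintegral_lintegral_swap (hMm.pow_const p).aemeasurable
      _ ≤ ENNReal.ofReal (c ^ p) ^ n * ∫⁻ y : Fin n → ℝ, ENNReal.ofReal (c ^ p) *
          ∫⁻ s : ℝ, g (Fin.cons s y : Fin (n + 1) → ℝ) ^ p := by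
        gcongr with y
        exact lintegral_intervalMaximal_rpow_le (hgs y) hp hc hroot
      _ = ENNReal.ofReal (c ^ p) ^ (n + 1) *
          ∫⁻ z : ℝ × (Fin n → ℝ), g (Fin.cons z.1 z.2 : Fin (n + 1) → ℝ) ^ p := by
        rw [lintegral_const_mul' _ _ (by finiteness), pow_succ, mul_assoc]
        congr 2
        exact (lintegral_prod_symm _ (measurable_comp_cons hPm).aemeasurable).symm

theorem eLpNorm_strongMaximal_le {p c : ℝ} (hp : 1 < p) (hc : 0 < c)
    (hroot : (p - 1) * c ^ p - p * c ^ (p - 1) - 1 = 0) {n : ℕ} {𝕜 : Type*} [RCLike 𝕜]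
    {f : (Fin n → ℝ) → 𝕜} (hf : AEStronglyMeasurable f volume) :
    eLpNorm (strongMaximal f) (ENNReal.ofReal p) volume ≤
      ENNReal.ofReal (c ^ n) * eLpNorm f (ENNReal.ofReal p) volume := by
  have hp0 : 0 < p := by linarith
  have hpE : ENNReal.ofReal p ≠ 0 := by simpa using hp0
  have hfe := hf.enorm
  rw [eLpNorm_eq_lintegral_rpow_enorm_toReal hpE ENNReal.ofReal_ne_top,
    eLpNorm_eq_lintegral_rpow_enorm_toReal hpE ENNReal.ofReal_ne_top,
    ENNReal.toReal_ofReal hp0.le, strongMaximal_eq_boxMaximal, boxMaximal_congr_ae hfe.ae_eq_mk]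
  have hle := lintegral_boxMaximal_rpow_le hp hc hroot n hfe.measurable_mk
  have heq : ∫⁻ x, hfe.mk (fun y => ‖f y‖ₑ) x ^ p = ∫⁻ x, ‖f x‖ₑ ^ p :=
    lintegral_congr_ae (hfe.ae_eq_mk.mono fun x hx => by simp only [hx])
  rw [heq] at hle
  simp only [enorm_eq_self]
  calc (∫⁻ x, boxMaximal (hfe.mk fun y => ‖f y‖ₑ) x ^ p) ^ (1 / p)
      ≤ (ENNReal.ofReal (c ^ p) ^ n * ∫⁻ x, ‖f x‖ₑ ^ p) ^ (1 / p) :=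
        ENNReal.rpow_le_rpow hle (by positivity)
    _ = ENNReal.ofReal (c ^ n) * (∫⁻ x, ‖f x‖ₑ ^ p) ^ (1 / p) := by
      rw [ENNReal.mul_rpow_of_nonneg _ _ (by positivity)]
      congr 1
      rw [← ENNReal.ofReal_pow (by positivity),
        ENNReal.ofReal_rpow_of_nonneg (by positivity) (by positivity)]
      congr 1
      rw [← Real.rpow_natCast, ← Real.rpow_natCast, ← Real.rpow_mul hc.le, ← Real.rpow_mul hc.le]
      congr 1
      field_simp

/-! ### Truncated powers and the lower bound. -/

theorem lintegral_Icc_zero_abs_rpow {α u : ℝ} (hα : α < 1) (hu : 0 ≤ u) :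
    ∫⁻ y in Set.Icc 0 u, ENNReal.ofReal (|y| ^ (-α)) = ENNReal.ofReal (u ^ (1 - α) / (1 - α)) := by
  have hlint : IntegrableOn (fun y : ℝ => y ^ (-α)) (Set.Ioc 0 u) := by
    rw [← intervalIntegrable_iff_integrableOn_Ioc_of_le hu]
    exact intervalIntegral.intervalIntegrable_rpow' (by linarith)
  have hval : ∫ y in Set.Ioc 0 u, y ^ (-α) = u ^ (1 - α) / (1 - α) := by
    rw [← intervalIntegral.integral_of_le hu, integral_rpow (Or.inl (by linarith)),
      Real.zero_rpow (by linarith)]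
    rw [sub_zero, neg_add_eq_sub]
  rw [setLIntegral_congr Ioc_ae_eq_Icc.symm, ← hval,
    ofReal_integral_eq_lintegral_ofReal hlint ((ae_restrict_mem measurableSet_Ioc).mono
      fun y hy => Real.rpow_nonneg hy.1.le _)]
  exact setLIntegral_congr_fun measurableSet_Ioc fun y hy => by simp only [abs_of_pos hy.1]

theorem lintegral_Icc_neg_abs_rpow {α u v : ℝ} (hα : α < 1) (hu : 0 ≤ u) (hv : 0 ≤ v) :
    ∫⁻ y in Set.Icc (-u) v, ENNReal.ofReal (|y| ^ (-α)) =
      ENNReal.ofReal ((u ^ (1 - α) + v ^ (1 - α)) / (1 - α)) := by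
  have hneg : ∫⁻ y in Set.Icc (-u) 0, ENNReal.ofReal (|y| ^ (-α)) =
      ∫⁻ y in Set.Icc 0 u, ENNReal.ofReal (|y| ^ (-α)) := by
    rw [← (Measure.measurePreserving_neg (volume : Measure ℝ)).setLIntegral_comp_preimage_emb
      (MeasurableEquiv.neg ℝ).measurableEmbedding _ (Set.Icc 0 u)]
    simp
  have h1α : 0 < 1 - α := by linarith
  rw [← Set.Ico_union_Icc_eq_Icc (neg_nonpos.2 hu) hv, lintegral_union measurableSet_Icc
    (Set.disjoint_left.2 fun y hy hy' => absurd hy.2 (not_lt.2 hy'.1)),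
    setLIntegral_congr Ico_ae_eq_Icc, hneg, lintegral_Icc_zero_abs_rpow hα hu,
    lintegral_Icc_zero_abs_rpow hα hv, ← ENNReal.ofReal_add (by positivity) (by positivity),
    add_div]

/-- The truncated power `|x| ^ (-α)` on `[-1, 1]`. -/
noncomputable def truncPow (α : ℝ) : ℝ → ℝ :=
  (Set.Icc (-1) 1).indicator fun x => |x| ^ (-α)

theorem truncPow_nonneg (α x : ℝ) : 0 ≤ truncPow α x :=
  Set.indicator_nonneg (fun _ _ => by positivity) x

theorem measurable_truncPow (α : ℝ) : Measurable (truncPow α) :=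
  Measurable.indicator (by fun_prop) measurableSet_Icc

theorem lintegral_truncPow_rpow {α p : ℝ} (hp : 0 < p) (hα : α * p < 1) :
    ∫⁻ x, ENNReal.ofReal (truncPow α x) ^ p = ENNReal.ofReal (2 / (1 - α * p)) := by
  have : ∀ x, ENNReal.ofReal (truncPow α x) ^ p =
      (Set.Icc (-1) 1).indicator (fun x => ENNReal.ofReal (|x| ^ (-(α * p)))) x := by
    intro x
    by_cases hx : x ∈ Set.Icc (-1 : ℝ) 1
    · rw [truncPow, Set.indicator_of_mem hx, Set.indicator_of_mem hx,
        ENNReal.ofReal_rpow_of_nonneg (by positivity) hp.le, ← Real.rpow_mul (abs_nonneg x),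
        neg_mul]
    · rw [truncPow, Set.indicator_of_notMem hx, Set.indicator_of_notMem hx, ENNReal.ofReal_zero,
        ENNReal.zero_rpow_of_pos hp]
  simp_rw [this]
  rw [lintegral_indicator measurableSet_Icc, lintegral_Icc_neg_abs_rpow hα zero_le_one zero_le_one,
    Real.one_rpow, one_add_one_eq_two]

theorem le_lintegral_truncPow {α u v a b : ℝ} (hα : α < 1) (hu : 0 ≤ u) (hu1 : u ≤ 1) (hv : 0 ≤ v)
    (hv1 : v ≤ 1) (ha : a ≤ -u) (hb : v ≤ b) :
    ENNReal.ofReal ((u ^ (1 - α) + v ^ (1 - α)) / (1 - α)) ≤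
      ∫⁻ y in Set.Icc a b, ENNReal.ofReal (truncPow α y) := by
  rw [← lintegral_Icc_neg_abs_rpow hα hu hv]
  calc ∫⁻ y in Set.Icc (-u) v, ENNReal.ofReal (|y| ^ (-α))
      = ∫⁻ y in Set.Icc (-u) v, ENNReal.ofReal (truncPow α y) := by
        refine setLIntegral_congr_fun measurableSet_Icc fun y hy => ?_
        have : y ∈ Set.Icc (-1 : ℝ) 1 := ⟨by linarith [hy.1], by linarith [hy.2]⟩
        simp only [truncPow, Set.indicator_of_mem this]
    _ ≤ _ := lintegral_mono_set (Set.Icc_subset_Icc ha hb)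

/-- The factor by which the maximal function enlarges `truncPow α`, found by averaging over
`[-s * x, (1 + δ) * x]`. -/
noncomputable def truncPowFactor (α s δ : ℝ) : ℝ :=
  (1 + s ^ (1 - α)) / ((1 - α) * (1 + δ + s))

/-- By homogeneity, the integral of |y|^(-α) between -s x and x is a constant times |x|^(1-α). The
overshoot δ puts x strictly inside the interval; `s ≤ 1` keeps -s x in [-1, 1], where the truncation
is not felt. Negative x are handled by reflection. -/
theorem exists_interval_truncPow {α s δ : ℝ} (hα0 : 0 < α) (hα : α < 1) (hs : 0 < s) (hs1 : s ≤ 1)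
    (hδ : 0 < δ) (x : ℝ) : ∃ a b, a < x ∧ x < b ∧
      ENNReal.ofReal (truncPowFactor α s δ * truncPow α x) ≤
        (ENNReal.ofReal (b - a))⁻¹ * ∫⁻ y in Set.Icc a b, ENNReal.ofReal (truncPow α y) := by
  by_cases hx : x ∈ Set.Icc (-1 : ℝ) 1 ∧ x ≠ 0
  swap
  -- Here `truncPow` vanishes, also at x = 0 since `0 ^ (-α) = 0` for α ≠ 0, so any interval around
  -- x serves.
  · refine ⟨x - 1, x + 1, by linarith, by linarith, ?_⟩
    have : truncPow α x = 0 := by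
      by_cases h1 : x ∈ Set.Icc (-1 : ℝ) 1
      · have : x = 0 := by tauto
        rw [truncPow, Set.indicator_of_mem h1, this, abs_zero, Real.zero_rpow (by linarith)]
      · rw [truncPow, Set.indicator_of_notMem h1]
    simp [this]
  obtain ⟨hx1, hx0⟩ := hx
  have hax : 0 < |x| := abs_pos.2 hx0
  have hax1 : |x| ≤ 1 := abs_le.2 hx1
  have h1α : 0 < 1 - α := by linarith
  have hval : truncPowFactor α s δ * truncPow α x * ((1 + δ + s) * |x|) =
      ((s * |x|) ^ (1 - α) + |x| ^ (1 - α)) / (1 - α) := by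
    rw [truncPow, Set.indicator_of_mem hx1, truncPowFactor, Real.mul_rpow hs.le hax.le,
      show 1 - α = -α + 1 by ring, Real.rpow_add_one hax.ne']
    have : -α + 1 ≠ 0 := by linarith
    have : 1 + δ + s ≠ 0 := by linarith
    field_simp
    ring
  have hsx : 0 < s * |x| := by positivity
  have hdx : 0 < δ * |x| := by positivity
  have hsx1 : s * |x| ≤ 1 := mul_le_one₀ hs1 hax.le hax1
  have main : ∀ a b : ℝ, b - a = (1 + δ + s) * |x| →
      ENNReal.ofReal (((s * |x|) ^ (1 - α) + |x| ^ (1 - α)) / (1 - α)) ≤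
        ∫⁻ y in Set.Icc a b, ENNReal.ofReal (truncPow α y) →
      ENNReal.ofReal (truncPowFactor α s δ * truncPow α x) ≤
        (ENNReal.ofReal (b - a))⁻¹ * ∫⁻ y in Set.Icc a b, ENNReal.ofReal (truncPow α y) := by
    intro a b hab h
    have hpos : 0 < b - a := by rw [hab]; positivity
    rw [← hval, ← hab, ENNReal.ofReal_mul' hpos.le] at h
    rwa [mul_comm (ENNReal.ofReal _)⁻¹, ← div_eq_mul_inv, ENNReal.le_div_iff_mul_le (Or.inl (by simpa using hpos))
      (Or.inl ENNReal.ofReal_ne_top)]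
  rcases lt_or_gt_of_ne hx0 with hneg | hpos
  · rw [abs_of_neg hneg] at *
    refine ⟨(1 + δ) * x, -(s * x), by linarith, by linarith, main _ _ (by ring) ?_⟩
    rw [add_comm]
    exact le_lintegral_truncPow hα hax.le hax1 hsx.le hsx1 (by linarith) (by linarith)
  · rw [abs_of_pos hpos] at *
    refine ⟨-(s * x), (1 + δ) * x, by linarith, by linarith, main _ _ (by ring) ?_⟩
    exact le_lintegral_truncPow hα hsx.le hsx1 hax.le hax1 (by linarith) (by linarith)

theorem lintegral_fin_prod_eq_prod {n : ℕ} (μ : Fin n → Measure ℝ) [∀ i, SigmaFinite (μ i)]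
    {h : ℝ → ℝ≥0∞} (hh : Measurable h) :
    ∫⁻ x, ∏ i, h (x i) ∂(Measure.pi μ) = ∏ i, ∫⁻ x, h x ∂(μ i) := by
  induction n with
  | zero => simp
  | succ n ih =>
    have hm : Measurable fun x : Fin n → ℝ => ∏ i, h (x i) :=
      Finset.measurable_prod _ fun i _ => hh.comp (measurable_pi_apply i)
    rw [← (measurePreserving_piFinSuccAbove μ 0).symm.lintegral_comp_emb
      (MeasurableEquiv.measurableEmbedding _)]
    simp_rw [piFinSuccAbove_zero_symm_eq_cons, Fin.prod_univ_succ, Fin.cons_zero, Fin.cons_succ]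
    rw [lintegral_prod_mul hh.aemeasurable hm.aemeasurable]
    congr 1
    exact ih fun i => μ i.succ

/-- The average of a product function over a box is the product of its averages over the sides,
which can be chosen separately in each coordinate. -/
theorem prod_le_boxMaximal_prod {n : ℕ} {h k : ℝ → ℝ≥0∞} (hh : Measurable h)
    (H : ∀ x, ∃ a b, a < x ∧ x < b ∧
      k x ≤ (ENNReal.ofReal (b - a))⁻¹ * ∫⁻ y in Set.Icc a b, h y) (x : Fin n → ℝ) :
    ∏ i, k (x i) ≤ boxMaximal (fun y => ∏ i, h (y i)) x := by
  choose a b ha hb hab using H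
  refine le_iSup_of_le (fun i => a (x i)) (le_iSup_of_le (fun i => b (x i))
    (le_iSup_of_le (fun i => ⟨ha _, hb _⟩) ?_))
  rw [← Set.pi_univ_Icc, volume_pi, Measure.restrict_pi_pi, lintegral_fin_prod_eq_prod _ hh,
    ENNReal.prod_inv_distrib (fun _ _ _ _ _ => Or.inr ENNReal.ofReal_ne_top),
    ← Finset.prod_mul_distrib]
  exact Finset.prod_le_prod' fun i _ => hab (x i)

/-- Test on the product of truncated powers: `α * p < 1` makes its norm finite, and the norm is
nonzero, so it can be cancelled. -/
theorem truncPowFactor_pow_le_lpOperatorNorm {α s δ p : ℝ} (hp : 1 < p) (hα0 : 0 < α)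
    (hα : α * p < 1) (hs : 0 < s) (hs1 : s ≤ 1) (hδ : 0 < δ) (n : ℕ)
    {𝕜 : Type*} [RCLike 𝕜] :
    ENNReal.ofReal (truncPowFactor α s δ) ^ n ≤
      lpOperatorNorm (strongMaximal (n := n) (𝕜 := 𝕜)) (ENNReal.ofReal p) volume := by
  have hp0 : 0 < p := by linarith
  have hα1 : α < 1 := by nlinarith
  have h1α : 0 < 1 - α := by linarith
  have hpE : ENNReal.ofReal p ≠ 0 := by simpa using hp0
  set K := ENNReal.ofReal (truncPowFactor α s δ) with hK
  have hfac : 0 ≤ truncPowFactor α s δ := by unfold truncPowFactor; positivity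
  set f : (Fin n → ℝ) → 𝕜 := fun x => ((∏ i, truncPow α (x i) : ℝ) : 𝕜) with hf
  have hfe : ∀ x, ‖f x‖ₑ = ∏ i, ENNReal.ofReal (truncPow α (x i)) := by
    intro x
    rw [← ofReal_norm, RCLike.norm_ofReal, abs_of_nonneg
      (Finset.prod_nonneg fun i _ => truncPow_nonneg _ _),
      ENNReal.ofReal_prod_of_nonneg fun i _ => truncPow_nonneg _ _]
  have hfm : Measurable f := by
    refine RCLike.measurable_ofReal.comp (Finset.measurable_prod _ fun i _ => ?_)
    exact (measurable_truncPow α).comp (measurable_pi_apply i)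
  have hlint : ∫⁻ x, ‖f x‖ₑ ^ p = ENNReal.ofReal (2 / (1 - α * p)) ^ n := by
    simp_rw [hfe, ← ENNReal.prod_rpow_of_nonneg hp0.le]
    rw [volume_pi, lintegral_fin_prod_eq_prod (h := fun x => ENNReal.ofReal (truncPow α x) ^ p) _
      ((measurable_truncPow α).ennreal_ofReal.pow_const p)]
    simp [lintegral_truncPow_rpow hp0 hα]
  have hnorm : eLpNorm f (ENNReal.ofReal p) volume =
      (ENNReal.ofReal (2 / (1 - α * p)) ^ n) ^ (1 / p) := by
    rw [eLpNorm_eq_lintegral_rpow_enorm_toReal hpE ENNReal.ofReal_ne_top,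
      ENNReal.toReal_ofReal hp0.le, hlint]
  have hval : 0 < 2 / (1 - α * p) := div_pos two_pos (by linarith)
  have hne : eLpNorm f (ENNReal.ofReal p) volume ≠ ∞ := by
    rw [hnorm]
    exact ENNReal.rpow_ne_top_of_nonneg (by positivity) (by finiteness)
  have hne0 : eLpNorm f (ENNReal.ofReal p) volume ≠ 0 := by
    rw [hnorm]
    refine (ENNReal.rpow_pos (ENNReal.pow_pos (by simpa using hval) n) (by finiteness)).ne'
  have hpt : ∀ x, K ^ n * ‖f x‖ₑ ≤ strongMaximal f x := by
    intro x
    have := prod_le_boxMaximal_prod (n := n)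
      (k := fun x => ENNReal.ofReal (truncPowFactor α s δ * truncPow α x))
      (measurable_truncPow α).ennreal_ofReal
      (exists_interval_truncPow hα0 hα1 hs hs1 hδ) x
    simp_rw [ENNReal.ofReal_mul hfac, Finset.prod_mul_distrib, Finset.prod_const,
      Finset.card_univ, Fintype.card_fin, ← hfe] at this
    exact this
  refine le_sInf fun C hC => ?_
  have hCf := hC f ⟨hfm.aestronglyMeasurable, hne.lt_top⟩
  have hlow : K ^ n * eLpNorm f (ENNReal.ofReal p) volume ≤
      eLpNorm (strongMaximal f) (ENNReal.ofReal p) volume := by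
    rw [eLpNorm_eq_lintegral_rpow_enorm_toReal hpE ENNReal.ofReal_ne_top,
      eLpNorm_eq_lintegral_rpow_enorm_toReal hpE ENNReal.ofReal_ne_top,
      ENNReal.toReal_ofReal hp0.le]
    calc K ^ n * (∫⁻ x, ‖f x‖ₑ ^ p) ^ (1 / p)
        = (∫⁻ x, (K ^ n * ‖f x‖ₑ) ^ p) ^ (1 / p) := by
          simp_rw [ENNReal.mul_rpow_of_nonneg _ _ hp0.le]
          rw [lintegral_const_mul _ (hfm.enorm.pow_const p),
            ENNReal.mul_rpow_of_nonneg _ _ (by positivity), ← ENNReal.rpow_mul,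
            mul_one_div_cancel hp0.ne', ENNReal.rpow_one]
      _ ≤ _ := by
          gcongr with x
          simpa using hpt x
  exact (ENNReal.mul_le_mul_iff_left hne0 hne).1 (hlow.trans hCf)

/-- For s = c^(-p), α = 1/p and δ = 0 the factor is p(1 + c^(1-p)) / ((p - 1)(1 + c^(-p))), which
equals c precisely by the equation for c. One parameter δ drives both α up to 1/p and the overshoot
down to 0. -/
theorem tendsto_truncPowFactor {p c : ℝ} (hp : 1 < p) (hc : 0 < c)
    (hroot : (p - 1) * c ^ p - p * c ^ (p - 1) - 1 = 0) :
    Filter.Tendsto (fun δ => truncPowFactor (1 / p - δ) (c ^ (-p)) δ)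
      (nhdsWithin 0 (Set.Ioi 0)) (nhds c) := by
  have hp0 : 0 < p := by linarith
  have hs : 0 < c ^ (-p) := Real.rpow_pos_of_pos hc _
  have hp1 : 1 / p < 1 := by rw [div_lt_one hp0]; exact hp
  have hval : truncPowFactor (1 / p - 0) (c ^ (-p)) 0 = c := by
    unfold truncPowFactor
    rw [← Real.rpow_mul hc.le, show -p * (1 - (1 / p - 0)) = -(p - 1) by field_simp; ring,
      Real.rpow_neg hc.le, Real.rpow_neg hc.le]
    have hcp : c ^ p = c ^ (p - 1) * c := by
      rw [← Real.rpow_add_one hc.ne']; congr 1; ring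
    have hd : 0 < c ^ (p - 1) := by positivity
    rw [hcp] at hroot ⊢
    generalize c ^ (p - 1) = d at *
    have h1 : 0 < (1 - (1 / p - 0)) * (1 + 0 + (d * c)⁻¹) := by
      refine mul_pos (by linarith) (by positivity)
    rw [div_eq_iff h1.ne']
    field_simp
    linarith
  have hcont : ContinuousAt (fun δ => truncPowFactor (1 / p - δ) (c ^ (-p)) δ) 0 := by
    unfold truncPowFactor
    refine ContinuousAt.div ?_ (by fun_prop) ?_
    · exact continuousAt_const.add (ContinuousAt.rpow continuousAt_const (by fun_prop)
        (Or.inl hs.ne'))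
    · exact (mul_pos (by linarith) (by linarith)).ne'
  have := hcont.tendsto
  rw [hval] at this
  exact this.mono_left nhdsWithin_le_nhds

/-! ### The operator norm. -/

theorem mainTheorem2 {𝕜 : Type*} [RCLike 𝕜] (n : ℕ) (p : ℝ) (hp : 1 < p) :
    (∃! c : ℝ, 0 < c ∧ (p - 1) * c ^ p - p * c ^ (p - 1) - 1 = 0) ∧
    (∀ f : (Fin n → ℝ) → 𝕜, MemLp f (ENNReal.ofReal p) volume →
      MemLp (strongMaximal f) (ENNReal.ofReal p) volume) ∧
    ∀ c : ℝ, 0 < c → (p - 1) * c ^ p - p * c ^ (p - 1) - 1 = 0 →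
      lpOperatorNorm (strongMaximal (n := n) (𝕜 := 𝕜)) (ENNReal.ofReal p) volume =
        ENNReal.ofReal (c ^ n) := by
  refine ⟨existsUnique_root hp, fun f hf => ?_, fun c hc hroot => le_antisymm ?_ ?_⟩
  · obtain ⟨c, ⟨hc, hroot⟩, -⟩ := existsUnique_root hp
    refine ⟨(measurable_boxMaximal _).aestronglyMeasurable, ?_⟩
    exact (eLpNorm_strongMaximal_le hp hc hroot hf.1).trans_lt
      (ENNReal.mul_lt_top ENNReal.ofReal_lt_top hf.2)
  · exact sInf_le fun f hf => eLpNorm_strongMaximal_le hp hc hroot hf.1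
  · have hp0 : 0 < p := by linarith
    have hc1 := one_lt_of_root hp hc hroot
    rw [ENNReal.ofReal_pow hc.le]
    refine le_of_tendsto (((ENNReal.continuous_pow n).comp
      ENNReal.continuous_ofReal).continuousAt.tendsto.comp (tendsto_truncPowFactor hp hc hroot)) ?_
    have hpos : (0 : ℝ) < 1 / p := by positivity
    -- For 0 < δ < 1/p the exponent α = 1/p - δ is positive and α p = 1 - δ p < 1; `s ≤ 1` because c
    -- > 1.
    filter_upwards [Ioo_mem_nhdsGT hpos] with δ hδ
    refine truncPowFactor_pow_le_lpOperatorNorm hp (by linarith [hδ.2]) ?_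
      (Real.rpow_pos_of_pos hc _) (Real.rpow_le_one_of_one_le_of_nonpos hc1.le (by linarith))
      hδ.1 n
    rw [sub_mul, one_div_mul_cancel hp0.ne']
    linarith [mul_pos hδ.1 hp0]
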